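/- **Setting.** Let $T\ge 0$, and let there be subsystems $n\in\mathcal N=\{1,\dots,N\}$ with agents $k\in\mathcal K^n=\{1,\dots,K^n\}$, $K^n\ge 1$. All variables below take values in finite non-empty sets. The primitive variables $X_0$, $W_{0:T}$, $V_t^{k,n}$ range independently over their feasible sets, and $$X_{t+1}=f_t(X_t,U_t^{1:N},W_t),\qquad Y_t^{k,n}=h_t^{k,n}(X_t,V_t^{k,n}).$$ The memory $M_t^{k,n}$ of an agent is a set of variables $M_t^{k,n}\subseteq\{Y_{0:t-1}^{i,m},U_{0:t-1}^{i,m}: i\in\mathcal K^m,\ m\ge n\}$ with perfect recall, $M_t^{k,n}\subseteq M_{t+1}^{k,n}$. Put $C_t^n=\bigcap_k M_t^{k,n}$ (common information), $L_t^{k,n}=M_t^{k,n}\setminus C_t^n$ (private information) and $Z_t^n=C_t^n\setminus C_{t-1}^n$, $C_{-1}^n=\emptyset$ (new information). For $m>n$ it is assumed that $C_t^m\subseteq C_t^n$, $Z_t^m\subseteq Z_t^n$ and $L_t^{k,m}\cap C_t^n=\emptyset$ for all $k\in\mathcal K^m$. Memories are updated only from current variables and memories: every variable in $M_{t+1}^{k,n}$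 that was realized before time $t$ belongs to some agent's memory at time $t$. **Problem 1.** Over all control strategies $\boldsymbol g$, $U_t^{k,n}=g_t^{k,n}(Y_t^{k,n},L_t^{k,n},C_t^n)$, minimize $\mathcal J(\boldsymbol g)=\max_{X_0,W_{0:T},V_{0:T}^{1:N}} d_T(X_T)$, where $d_T\ge0$. **Problem 2.** A partial action $\hat U_t^{n}=(\hat U_t^{k,n})_k$ of subsystem $n$ consists of maps $\hat U_t^{k,n}:\mathcal Y_t^{k,n}\times\mathcal L_t^{k,n}\to\mathcal U_t^{k,n}$, and it results in the actions $U_t^{k,n}=\hat U_t^{k,n}(Y_t^{k,n},L_t^{k,n})$. Over all partial strategies $\hat{\boldsymbol g}$, $\hat U_t^n=\hat g_t^n(C_t^n)$, minimize the worst-case cost $\hat{\mathcal J}(\hat{\boldsymbol g})=\max_{X_0,W_{0:T},V_{0:T}^{1:N}} d_T(X_T)$. The state of this problem is $\hat X_t=(X_t,(Y_t^{k,n},L_t^{k,n})_{k,n})$. **Information states.** These are defined recursively in $n$. A prescription $\Gamma_t^{[n,m]}$ by subsystem $n$ for subsystem $m<n$ is a map from the values of $(\Pi_t^m,\dots,\Pi_t^{n-1})$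 to the partial actions of subsystem $m$; it results in $\hat U_t^m=\Gamma_t^{[n,m]}(\Pi_t^{m:n-1})$. Given the realizations of $C_t^n$, of the prescriptions $\Gamma_{0:t-1}^{[n,m]}$, $m<n$, and of the partial actions $\hat U_{0:t-1}^{n:N}$, the information state $\Pi_t^n$ is the set of all values of $(\hat X_t,\Pi_t^1,\dots,\Pi_t^{n-1})$ that result, for some values of the primitive variables, from these prescriptions and partial actions together with the given realization of $C_t^n$. Here, in the presence of prescriptions by subsystem $n$, subsystem $i<n$ is subject to the prescriptions $\Gamma_t^{[i,m]}(\cdot)=\Gamma_t^{[n,m]}(\cdot,\Pi_t^{i:n-1})$, $m<i$. When partial actions are generated by laws $\hat U_t^n=\hat g_t^{*n}(\Pi_t^{n:N})$, where $\Pi_t^{n:N}=(\Pi_t^n,\dots,\Pi_t^N)$, the prescriptions are $\Gamma_t^{[n,m]}(\cdot)=\hat g_t^{*m}(\cdot,\Pi_t^{n:N})$; when actions are generated by laws $U_t^{k,n}=g_t^{*k,n}(Y_t^{k,n},L_t^{k,n},\Pi_t^{n:N})$, the partial actions are $\hat U_t^{k,n}=g_t^{*k,n}(\cdot,\cdot,\Pi_t^{n:N})$.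 **Theorem.** In Problem 2 there is an optimal partial strategy of the form $$\hat U_t^n=\hat g_t^{*n}(\Pi_t^{n:N}),\qquad n\in\mathcal N,\ t=0,\dots,T.$$ Furthermore, in Problem 1 there is an optimal control strategy of the form $$U_t^{k,n}=g_t^{*k,n}(Y_t^{k,n},L_t^{k,n},\Pi_t^{n:N}),\qquad k\in\mathcal K^n,\ n\in\mathcal N,\ t=0,\dots,T.$$ -/

import Mathlib

open scoped NNReal

/-- A sequence defined by feedback: the value at time `t` is `F u t`, where `u` agrees with the
sequence itself at all times `s < t` (and is arbitrary from `t` on). It is only used for maps `F`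
whose value at `t` depends on the past of its argument alone; see `causalFix_eq`. -/
noncomputable def causalFix {β : ℕ → Type} [∀ t, Nonempty (β t)]
    (F : (∀ s, β s) → ∀ t, β t) (t : ℕ) : β t :=
  F (fun s => if _h : s < t then causalFix F s else Classical.arbitrary (β s)) t
termination_by t

/-- If `F u t` depends only on the values of `u` before `t`, then `causalFix F` satisfies the
feedback equation at time `t`. -/
theorem causalFix_eq {β : ℕ → Type} [∀ t, Nonempty (β t)]
    (F : (∀ s, β s) → ∀ t, β t) (t : ℕ)
    (hF : ∀ u u' : ∀ s, β s, (∀ s, s < t → u s = u' s) → F u t = F u' t) :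
    causalFix F t = F (causalFix F) t := by
  rw [causalFix]
  apply hF
  intro s hs
  simp [hs]

/-- The (names of the) variables that memories may contain: the observation `Y_t^{k,n}` and the
action `U_t^{k,n}` of agent `k` of subsystem `n` at time `t`. Subsystems are numbered from `0`. -/
inductive Item {N : ℕ} (K : Fin N → ℕ) : Type
  | obs (t : ℕ) (n : Fin N) (k : Fin (K n)) : Item K
  | act (t : ℕ) (n : Fin N) (k : Fin (K n)) : Item K

/-- The time at which a variable is realized. -/
def Item.time {N : ℕ} {K : Fin N → ℕ} : Item K → ℕ
  | .obs t _ _ => t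
  | .act t _ _ => t

/-- The subsystem to which a variable belongs. -/
def Item.sub {N : ℕ} {K : Fin N → ℕ} : Item K → Fin N
  | .obs _ n _ => n
  | .act _ n _ => n

/-- Common information of subsystem `n` at time `t`: the intersection of its agents' memories. -/
def commonInfo {N : ℕ} {K : Fin N → ℕ} (M : ℕ → (n : Fin N) → Fin (K n) → Set (Item K))
    (t : ℕ) (n : Fin N) : Set (Item K) :=
  ⋂ k, M t n k

/-- Private information of agent `k` of subsystem `n` at time `t`. -/
def privateInfo {N : ℕ} {K : Fin N → ℕ} (M : ℕ → (n : Fin N) → Fin (K n) → Set (Item K))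
    (t : ℕ) (n : Fin N) (k : Fin (K n)) : Set (Item K) :=
  M t n k \ commonInfo M t n

/-- An information structure with nested subsystems on the horizon `0, …, T`. -/
structure NestedInfo (N : ℕ) (K : Fin N → ℕ) (T : ℕ) where
  /-- The memory of agent `k` of subsystem `n` at time `t`, as a set of variables. -/
  M : ℕ → (n : Fin N) → Fin (K n) → Set (Item K)
  /-- Memories contain past variables of the same or of succeeding subsystems. -/
  past : ∀ t ≤ T, ∀ n k, ∀ e ∈ M t n k, e.time < t ∧ n ≤ e.sub
  /-- Perfect recall. -/
  perfect_recall : ∀ t < T, ∀ n k, M t n k ⊆ M (t + 1) n k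
  /-- The common information is nested. -/
  nested : ∀ t ≤ T, ∀ n m : Fin N, n < m → commonInfo M t m ⊆ commonInfo M t n
  /-- The private information of an agent is disjoint from the common information of every
  preceding subsystem. -/
  separated : ∀ t ≤ T, ∀ n m : Fin N, n < m → ∀ k,
    Disjoint (privateInfo M t m k) (commonInfo M t n)
  /-- The new information is nested. (At time `0` all memories are empty.) -/
  nested_new : ∀ t < T, ∀ n m : Fin N, n < m →
    commonInfo M (t + 1) m \ commonInfo M t m ⊆ commonInfo M (t + 1) n \ commonInfo M t n
  /-- Memories are updated from memories and current variables only: a variable that is in a memory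
  at time `t + 1` and was realized before time `t` is in somebody's memory at time `t`. -/
  held : ∀ t < T, ∀ n k, ∀ e ∈ M (t + 1) n k, e.time < t → ∃ m j, e ∈ M t m j

/-- A decentralized system with nested subsystems and worst-case terminal cost. The families are
indexed by all of `ℕ`, but only the times `0, …, T` play a role. -/
structure NestedSystem (N : ℕ) (K : Fin N → ℕ) (T : ℕ) extends NestedInfo N K T where
  /-- states -/
  X : ℕ → Type
  /-- disturbances -/
  W : ℕ → Type
  /-- observation noises -/
  V : ℕ → (n : Fin N) → Fin (K n) → Type
  /-- observations -/
  Y : ℕ → (n : Fin N) → Fin (K n) → Type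
  /-- control actions -/
  U : ℕ → (n : Fin N) → Fin (K n) → Type
  finite_X : ∀ t, Finite (X t)
  finite_W : ∀ t, Finite (W t)
  finite_V : ∀ t n k, Finite (V t n k)
  finite_Y : ∀ t n k, Finite (Y t n k)
  finite_U : ∀ t n k, Finite (U t n k)
  nonempty_X : ∀ t, Nonempty (X t)
  nonempty_W : ∀ t, Nonempty (W t)
  nonempty_V : ∀ t n k, Nonempty (V t n k)
  nonempty_U : ∀ t n k, Nonempty (U t n k)
  /-- state dynamics -/
  f : ∀ t, X t → (∀ n k, U t n k) → W t → X (t + 1)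
  /-- observation maps -/
  h : ∀ t n k, X t → V t n k → Y t n k
  /-- terminal cost -/
  d : X T → ℝ≥0

namespace NestedSystem

attribute [instance] finite_X finite_W finite_V finite_Y finite_U
attribute [instance] nonempty_X nonempty_W nonempty_V nonempty_U

variable {N : ℕ} {K : Fin N → ℕ} {T : ℕ} (S : NestedSystem N K T)

/-- Common information `C_t^n`, as a set of variables. -/
def C (t : ℕ) (n : Fin N) : Set (Item K) := commonInfo S.M t n

/-- Private information `L_t^{k,n}`, as a set of variables. -/
def L (t : ℕ) (n : Fin N) (k : Fin (K n)) : Set (Item K) := privateInfo S.M t n k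

/-- The set of values of a variable. -/
def Val : Item K → Type
  | .obs t n k => S.Y t n k
  | .act t n k => S.U t n k

/-- The realizations of `C_t^n`. -/
abbrev CVal (t : ℕ) (n : Fin N) : Type := ∀ e : S.C t n, S.Val e.1

/-- The realizations of `L_t^{k,n}`. -/
abbrev LVal (t : ℕ) (n : Fin N) (k : Fin (K n)) : Type := ∀ e : S.L t n k, S.Val e.1

/-- A realization of all primitive variables; they vary independently of one another. -/
structure Prim where
  x0 : S.X 0
  w : ∀ t, S.W t
  v : ∀ t n k, S.V t n k

/-- Sequences of control actions of all agents. -/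
abbrev Acts : Type := ∀ t n k, S.U t n k

variable {S}

/-- The state `X_t` produced by primitive variables `ω` and control actions `u`. -/
def x (ω : S.Prim) (u : S.Acts) : ∀ t, S.X t
  | 0 => ω.x0
  | t + 1 => S.f t (x ω u t) (u t) (ω.w t)

/-- The observation `Y_t^{k,n}`. -/
def y (ω : S.Prim) (u : S.Acts) (t : ℕ) (n : Fin N) (k : Fin (K n)) : S.Y t n k :=
  S.h t n k (x ω u t) (ω.v t n k)

/-- The value of each variable. -/
def val (ω : S.Prim) (u : S.Acts) : ∀ e : Item K, S.Val e
  | .obs t n k => y ω u t n k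
  | .act t n k => u t n k

/-- The realization of `C_t^n`. -/
def c (ω : S.Prim) (u : S.Acts) (t : ℕ) (n : Fin N) : S.CVal t n := fun e => val ω u e.1

/-- The realization of `L_t^{k,n}`. -/
def l (ω : S.Prim) (u : S.Acts) (t : ℕ) (n : Fin N) (k : Fin (K n)) : S.LVal t n k :=
  fun e => val ω u e.1

variable (S)

/-! ### The original problem -/

/-- Control strategies: `U_t^{k,n} = g_t^{k,n}(Y_t^{k,n}, L_t^{k,n}, C_t^n)`. -/
abbrev ControlStrategy : Type :=
  ∀ t n k, S.Y t n k → S.LVal t n k → S.CVal t n → S.U t n k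

variable {S}

/-- The control actions generated by a control strategy. -/
noncomputable def actions (g : S.ControlStrategy) (ω : S.Prim) : S.Acts :=
  causalFix fun u t n k => g t n k (y ω u t n k) (l ω u t n k) (c ω u t n)

/-- Worst-case terminal cost of a control strategy: the maximum over the primitive variables (the
cost takes finitely many values, so the supremum is attained). -/
noncomputable def J (g : S.ControlStrategy) : ℝ≥0 :=
  ⨆ ω : S.Prim, S.d (x ω (actions g ω) T)

variable (S)

/-! ### The equivalent problem -/

/-- Partial actions of subsystem `n`: for each agent a map from `Y_t^{k,n}`, `L_t^{k,n}` to
control actions. -/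
abbrev PartialAction (t : ℕ) (n : Fin N) : Type :=
  ∀ k, S.Y t n k → S.LVal t n k → S.U t n k

/-- Partial strategies: the partial action of subsystem `n` is a function of `C_t^n`. -/
abbrev PartialStrategy : Type := ∀ t n, S.CVal t n → S.PartialAction t n

/-- The values of the new state, which consists of `X_t` and all `Y_t^{k,n}`, `L_t^{k,n}`. -/
abbrev XHat (t : ℕ) : Type := S.X t × (∀ n k, S.Y t n k × S.LVal t n k)

variable {S}

/-- The new state. -/
def xhat (ω : S.Prim) (u : S.Acts) (t : ℕ) : S.XHat t :=
  (x ω u t, fun n k => (y ω u t n k, l ω u t n k))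

/-- The control actions generated by a partial strategy: each agent applies its partial action to
its observation and private information. -/
noncomputable def partialActions (g : S.PartialStrategy) (ω : S.Prim) : S.Acts :=
  actions (fun t n k yk lk cn => g t n cn k yk lk) ω

/-- Terminal cost as a function of the new state. -/
def dhat (s : S.XHat T) : ℝ≥0 := S.d s.1

/-- Worst-case terminal cost of a partial strategy. -/
noncomputable def Jhat (g : S.PartialStrategy) : ℝ≥0 :=
  ⨆ ω : S.Prim, dhat (xhat ω (partialActions g ω) T)

variable (S)

/-! ### Information states -/

/-- The values of `(X̂_t, Π_t^0, …, Π_t^{j-1})`, where the information state `Π_t^i` is a set of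
values of `(X̂_t, Π_t^0, …, Π_t^{i-1})`. -/
def Lvl (t : ℕ) : ℕ → Type
  | 0 => S.XHat t
  | j + 1 => Lvl t j × Set (Lvl t j)

/-- The values of the tuple `(Π_t^m, …, Π_t^{j-1})` (the empty tuple if `j ≤ m`). -/
abbrev InfoTuple (t m j : ℕ) : Type := ∀ i : ℕ, m ≤ i → i < j → Set (S.Lvl t i)

/-- A complete action of level `j` at time `t`. It consists of a prescription for each subsystem
`m < j`, which is a map from `(Π_t^m, …, Π_t^{j-1})` to partial actions, and of a partial action of
each subsystem `m ≥ j` (a map from the empty tuple). For `j = n` these are the prescriptions by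
subsystem `n` and the partial actions of the subsystems `n, …, N-1`. For `j = N` this is a law of
the form `Û_t^m = g_t^m(Π_t^m, …, Π_t^{N-1})` for every subsystem `m`. -/
abbrev CompleteAction (t j : ℕ) : Type :=
  ∀ m : Fin N, S.InfoTuple t m j → S.PartialAction t m

variable {S}

/-- Append `Π_t^j` to `(Π_t^m, …, Π_t^{j-1})`. -/
def InfoTuple.append {t m j : ℕ} (p : S.InfoTuple t m j) (P : Set (S.Lvl t j)) :
    S.InfoTuple t m (j + 1) :=
  fun i hm _ => if h : i < j then p i hm h else
    (show i = j by omega) ▸ P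

/-- Supply `P` as the last argument of all prescriptions: the complete action of level `j` that a
complete action of level `j + 1` amounts to for subsystem `j`, which knows `Π_t^j = P`. -/
def CompleteAction.fix {t j : ℕ} (A : S.CompleteAction t (j + 1)) (P : Set (S.Lvl t j)) :
    S.CompleteAction t j :=
  fun m p => A m (InfoTuple.append p P)

/-- The component `Π_t^i` of `(X̂_t, Π_t^0, …, Π_t^{j-1})`. -/
def Lvl.info {t : ℕ} : ∀ j : ℕ, S.Lvl t j → ∀ i : ℕ, i < j → Set (S.Lvl t i)
  | 0, _, _, hi => absurd hi (Nat.not_lt_zero _)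
  | j + 1, s, i, hi => if h : i < j then Lvl.info j s.1 i h else
      (show i = j by omega) ▸ s.2

/-- Let `sim ω` be the control actions and the process with values in `β` that result from `ω`
under given complete actions. This is the set of values of the process at time `t` that are
compatible with the realization `cn` of the common information of subsystem `n`. -/
def feasible {β : ℕ → Type} (sim : S.Prim → S.Acts × (∀ t, β t)) (t : ℕ) (n : Fin N)
    (cn : S.CVal t n) : Set (β t) :=
  {s | ∃ ω : S.Prim, c ω (sim ω).1 t n = cn ∧ (sim ω).2 t = s}

/-- The control actions and the process `(X̂_t, Π_t^0, …, Π_t^{j-1})` that result from the primitive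
variables `ω` when the complete actions `A t` of level `j` are applied (open loop).

At level `j + 1`, subsystem `j` is at each time `t` subject to the complete action
`B t = (A t).fix Π_t^j` of level `j`, and its information state `Π_t^j` is the set of all
`(X̂_t, Π_t^0, …, Π_t^{j-1})` which, for some values of the primitive variables, result from the
complete actions `B 0, …, B (t-1)` together with the realization of `C_t^j` that has occurred. -/
noncomputable def simulate :
    ∀ j : ℕ, j ≤ N → (∀ t, S.CompleteAction t j) → S.Prim → S.Acts × (∀ t, S.Lvl t j)
  | 0, _, A, ω =>
      let u := actions (fun t n k yk lk _ =>
        A t n (fun i _ hi => absurd hi (Nat.not_lt_zero i)) k yk lk) ω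
      (u, fun t => xhat ω u t)
  | j + 1, hj, A, ω =>
      let sim := simulate j (Nat.le_of_succ_le hj)
      let P := fun (B : ∀ t, S.CompleteAction t j) (t : ℕ) =>
        feasible (sim B) t ⟨j, hj⟩ (c ω (sim B ω).1 t ⟨j, hj⟩)
      let B : ∀ t, S.CompleteAction t j := causalFix fun B t => (A t).fix (P B t)
      ((sim B ω).1, fun t => ((sim B ω).2 t, P B t))

variable (S)

/-- Structural partial strategies: laws `Û_t^n = g_t^n(Π_t^n, …, Π_t^{N-1})`. -/
abbrev StructuralPartialStrategy : Type := ∀ t, S.CompleteAction t N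

/-- Structural control strategies: laws
`U_t^{k,n} = g_t^{k,n}(Y_t^{k,n}, L_t^{k,n}, Π_t^n, …, Π_t^{N-1})`. -/
abbrev StructuralControlStrategy : Type :=
  ∀ t (n : Fin N) k, S.Y t n k → S.LVal t n k → S.InfoTuple t n N → S.U t n k

variable {S}

/-- The partial actions `g_t^{k,n}(·, ·, Π_t^n, …, Π_t^{N-1})` of a structural control strategy. -/
def StructuralControlStrategy.toPartial (g : S.StructuralControlStrategy) :
    S.StructuralPartialStrategy :=
  fun t n p k yk lk => g t n k yk lk p

/-- The realization of `(Π_t^n, …, Π_t^{N-1})` when the partial actions are generated by the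
structural partial strategy `g` and the primitive variables are `ω`. -/
noncomputable def infoStates (g : S.StructuralPartialStrategy) (ω : S.Prim) (t : ℕ) (n : Fin N) :
    S.InfoTuple t n N :=
  fun i _ hi => Lvl.info N ((simulate N le_rfl g ω).2 t) i hi

end NestedSystem

/-!
The information state `Π_t^j` is a set, its update uses only the previous set, the complete action
of level `j` and the new information of subsystem `j` (`IsMarkov.infoState_succ_congr`), and
`(X̂_t, Π_t^0, …, Π_t^{j-1})` is a Markov process driven by the complete actions of level `j`
(`isMarkov`). This rests on the information structure: new common information and new private
information are functions of the new state and the current actions (`newInfo_congr`,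
`l_succ_congr`).

The structural result is obtained without dynamic programming, by exchanging strategies level by
level. A policy of level `j` assigns to the primitive variables the complete actions of level `j`
that are applied; it is adapted if the prescriptions use `C_t^j` and the partial actions of later
subsystems use their own common information. From an adapted policy `α` of level `j` an adapted
policy of level `j + 1` arises as follows (`coarsen`): choose for each value `(P, c)` of
`(Π_t^j, C_t^{j+1})` that occurs under `α` one realization of the primitive variables producing it,
and, whenever `(P, c)` occurs, do what `α` does there. By induction on time, only pairs `(P, c)`
that occur under `α` occur under the new policy (`exists_infoState_eq`): every state in `P` is
reached by `α` with the information of the chosen realization, and the disturbances and noises after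
that are free, so that `α` can meet the same new information. As `Π_T^j` contains the current state,
all terminal states of the new policy are terminal states of `α`, and the worst-case cost does not
increase (`exists_state_eq`).

Starting from an optimal partial strategy, this leads to an adapted policy of level `N`, which does
not depend on the primitive variables at all, that is, to a structural strategy. Since
`Π_t^n, …, Π_t^{N-1}` are functions of `C_t^n` (`tuple_simulate_congr`), it is realized by a partial
strategy. A control strategy is a partial strategy with its arguments in another order, with the
same cost, which gives the result for the original problem.
-/

namespace NestedSystem

variable {N : ℕ} {K : Fin N → ℕ} {T : ℕ} {S : NestedSystem N K T}

/-! ### Causality of the primitive model -/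

instance : Nonempty S.Prim :=
  ⟨⟨Classical.arbitrary _, fun _ => Classical.arbitrary _, fun _ _ _ => Classical.arbitrary _⟩⟩

/-- The primitive variables on which `X_t` and `Y_t` depend take the same values. -/
def Prim.AgreeUpTo (ω ω' : S.Prim) (t : ℕ) : Prop :=
  ω.x0 = ω'.x0 ∧ (∀ s < t, ω.w s = ω'.w s) ∧ ∀ s ≤ t, ω.v s = ω'.v s

theorem Prim.AgreeUpTo.mono {ω ω' : S.Prim} {s t : ℕ} (h : ω.AgreeUpTo ω' t) (hst : s ≤ t) :
    ω.AgreeUpTo ω' s :=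
  ⟨h.1, fun r hr => h.2.1 r (by omega), fun r hr => h.2.2 r (by omega)⟩

theorem Prim.AgreeUpTo.refl (ω : S.Prim) (t : ℕ) : ω.AgreeUpTo ω t :=
  ⟨rfl, fun _ _ => rfl, fun _ _ => rfl⟩

/-- The primitive variables that coincide with `ω` as far as `X_t` and `Y_t` are concerned, and with
`ω'` afterwards. -/
def Prim.splice (ω ω' : S.Prim) (t : ℕ) : S.Prim where
  x0 := ω.x0
  w s := if s < t then ω.w s else ω'.w s
  v s := if s ≤ t then ω.v s else ω'.v s

theorem Prim.splice_agree (ω ω' : S.Prim) (t : ℕ) : (ω.splice ω' t).AgreeUpTo ω t :=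
  ⟨rfl, fun s hs => by simp [splice, hs], fun s hs => by simp [splice, hs]⟩

theorem Prim.splice_w (ω ω' : S.Prim) (t : ℕ) : (ω.splice ω' t).w t = ω'.w t := by
  simp [splice]

theorem Prim.splice_v (ω ω' : S.Prim) (t : ℕ) : (ω.splice ω' t).v (t + 1) = ω'.v (t + 1) := by
  simp [splice]

theorem x_congr {ω ω' : S.Prim} {u u' : S.Acts} {t : ℕ} (hω : ω.AgreeUpTo ω' t)
    (hu : ∀ s < t, u s = u' s) : x ω u t = x ω' u' t := by
  induction t with
  | zero => exact hω.1
  | succ t ih =>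
    simp only [x]
    rw [ih (hω.mono t.le_succ) (fun s hs => hu s (by omega)), hu t (by omega),
      hω.2.1 t (by omega)]

theorem y_congr {ω ω' : S.Prim} {u u' : S.Acts} {t : ℕ} (hω : ω.AgreeUpTo ω' t)
    (hu : ∀ s < t, u s = u' s) : y ω u t = y ω' u' t := by
  funext n k
  simp only [y]
  rw [x_congr hω hu, hω.2.2 t le_rfl]

theorem val_congr {ω ω' : S.Prim} {u u' : S.Acts} {t : ℕ} (hω : ω.AgreeUpTo ω' t)
    (hu : ∀ s < t, u s = u' s) {e : Item K} (he : e.time < t) : val ω u e = val ω' u' e := by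
  cases e with
  | obs s n k =>
    exact congrFun (congrFun (y_congr (hω.mono (le_of_lt he))
      (fun r hr => hu r (lt_trans hr he))) n) k
  | act s n k => exact congrFun (congrFun (hu s he) n) k

theorem l_congr {ω ω' : S.Prim} {u u' : S.Acts} {t : ℕ} (ht : t ≤ T) (hω : ω.AgreeUpTo ω' t)
    (hu : ∀ s < t, u s = u' s) : l ω u t = l ω' u' t := by
  funext n k e
  exact val_congr hω hu (S.past t ht n k e.1 e.2.1).1

theorem xhat_congr {ω ω' : S.Prim} {u u' : S.Acts} {t : ℕ} (ht : t ≤ T) (hω : ω.AgreeUpTo ω' t)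
    (hu : ∀ s < t, u s = u' s) : xhat ω u t = xhat ω' u' t := by
  simp only [xhat]
  rw [x_congr hω hu, y_congr hω hu, l_congr ht hω hu]

/-! ### The information structure -/

variable (S) in
/-- The common information `C_t^j` for an arbitrary natural number `j`, with `C_t^j = ∅` if there
is no subsystem `j`. In particular `C_t^N = ∅`: a coordinator above all subsystems knows nothing. -/
def condInfo (t j : ℕ) : Set (Item K) := {e | ∃ h : j < N, e ∈ S.C t ⟨j, h⟩}

/-- The realization of `C_t^j`. -/
def cond (ω : S.Prim) (u : S.Acts) (t j : ℕ) : ∀ e : S.condInfo t j, S.Val e.1 :=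
  fun e => val ω u e.1

theorem cond_eq_iff {ω ω' : S.Prim} {u u' : S.Acts} {t j : ℕ} :
    cond ω u t j = cond ω' u' t j ↔ ∀ e ∈ S.condInfo t j, val ω u e = val ω' u' e :=
  ⟨fun h e he => congrFun h ⟨e, he⟩, fun h => funext fun e => h e.1 e.2⟩

theorem c_eq_iff {ω ω' : S.Prim} {u u' : S.Acts} {t : ℕ} {n : Fin N} :
    c ω u t n = c ω' u' t n ↔ cond ω u t n = cond ω' u' t n := by
  rw [cond_eq_iff]
  exact ⟨fun h e he => congrFun h ⟨e, he.2⟩, fun h => funext fun e => h e.1 ⟨n.2, e.2⟩⟩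

theorem C_mono {s t : ℕ} (hst : s ≤ t) (ht : t ≤ T) (n : Fin N) : S.C s n ⊆ S.C t n := by
  induction t, hst using Nat.le_induction with
  | base => exact subset_rfl
  | succ t _ ih =>
    exact (ih (by omega)).trans
      (Set.iInter_mono fun k => S.perfect_recall t (by omega) n k)

theorem condInfo_subset {s t i j : ℕ} (hst : s ≤ t) (ht : t ≤ T) (hij : i ≤ j) :
    S.condInfo s j ⊆ S.condInfo t i := by
  rintro e ⟨h, he⟩
  refine ⟨by omega, C_mono hst ht _ ?_⟩
  rcases hij.eq_or_lt with rfl | hij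
  · exact he
  · exact S.nested s (by omega) ⟨i, by omega⟩ ⟨j, h⟩ hij he

theorem cond_mono {ω ω' : S.Prim} {u u' : S.Acts} {s t i j : ℕ} (hst : s ≤ t) (ht : t ≤ T)
    (hij : i ≤ j) (h : cond ω u t i = cond ω' u' t i) : cond ω u s j = cond ω' u' s j := by
  rw [cond_eq_iff] at h ⊢
  exact fun e he => h e (condInfo_subset hst ht hij he)

theorem cond_succ {ω ω' : S.Prim} {u u' : S.Acts} {t j : ℕ}
    (h : cond ω u t j = cond ω' u' t j)
    (hnew : ∀ e ∈ S.condInfo (t + 1) j, e ∉ S.condInfo t j → val ω u e = val ω' u' e) :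
    cond ω u (t + 1) j = cond ω' u' (t + 1) j := by
  rw [cond_eq_iff] at h ⊢
  intro e he
  by_cases he' : e ∈ S.condInfo t j
  · exact h e he'
  · exact hnew e he he'

theorem time_lt_of_mem_condInfo (hK : ∀ n, 0 < K n) {t j : ℕ} (ht : t ≤ T) {e : Item K}
    (he : e ∈ S.condInfo t j) : e.time < t := by
  obtain ⟨h, he⟩ := he
  exact (S.past t ht ⟨j, h⟩ ⟨0, hK _⟩ e (Set.mem_iInter.1 he _)).1

theorem cond_congr (hK : ∀ n, 0 < K n) {ω ω' : S.Prim} {u u' : S.Acts} {t : ℕ} (j : ℕ)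
    (ht : t ≤ T) (hω : ω.AgreeUpTo ω' t) (hu : ∀ s < t, u s = u' s) :
    cond ω u t j = cond ω' u' t j :=
  cond_eq_iff.2 fun _ he => val_congr hω hu (time_lt_of_mem_condInfo hK ht he)

theorem cond_zero (hK : ∀ n, 0 < K n) (ω ω' : S.Prim) (u u' : S.Acts) (j : ℕ) :
    cond ω u 0 j = cond ω' u' 0 j :=
  cond_eq_iff.2 fun _ he =>
    absurd (time_lt_of_mem_condInfo hK (Nat.zero_le T) he) (Nat.not_lt_zero _)

/-- The new state and the actions at time `t` determine every variable that is realized at time `t`,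
or that is held in a memory at time `t` without being common information of any subsystem. -/
theorem val_eq_of_held {ω ω' : S.Prim} {u u' : S.Acts} {t : ℕ} (hx : xhat ω u t = xhat ω' u' t)
    (hu : u t = u' t) {e : Item K} (het : e.time < t + 1)
    (hold : e.time < t → ∃ m j, e ∈ S.M t m j) (hC : ∀ m, e ∉ S.C t m) :
    val ω u e = val ω' u' e := by
  have hyl : ∀ n k, y ω u t n k = y ω' u' t n k ∧ l ω u t n k = l ω' u' t n k := fun n k =>
    Prod.ext_iff.1 (congrFun (congrFun (congrArg Prod.snd hx) n) k)
  rcases (Nat.lt_succ_iff.1 het).eq_or_lt with h | h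
  · cases e with
    | obs s n k => obtain rfl : s = t := h; exact (hyl n k).1
    | act s n k => obtain rfl : s = t := h; exact congrFun (congrFun hu n) k
  · obtain ⟨m, j, he⟩ := hold h
    exact congrFun (hyl m j).2 ⟨e, he, hC m⟩

/-- The new information at time `t + 1` is a function of the new state and the actions at time
`t`. -/
theorem newInfo_congr (hK : ∀ n, 0 < K n) {ω ω' : S.Prim} {u u' : S.Acts} {t : ℕ} (ht : t < T)
    (hx : xhat ω u t = xhat ω' u' t) (hu : u t = u' t) {j : ℕ} {e : Item K}
    (he : e ∈ S.condInfo (t + 1) j) (he' : e ∉ S.condInfo t j) : val ω u e = val ω' u' e := by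
  refine val_eq_of_held hx hu (time_lt_of_mem_condInfo hK ht he) ?_ ?_
  · obtain ⟨h, he⟩ := he
    exact S.held t ht ⟨j, h⟩ ⟨0, hK _⟩ e (Set.mem_iInter.1 he _)
  · intro m hm
    obtain ⟨h, he⟩ := he
    rcases lt_or_ge m.val j with hmj | hmj
    · exact (S.nested_new t ht m ⟨j, h⟩ hmj ⟨he, fun h' => he' ⟨h, h'⟩⟩).2 hm
    · exact he' (condInfo_subset le_rfl ht.le hmj ⟨m.2, hm⟩)

theorem l_succ_congr {ω ω' : S.Prim} {u u' : S.Acts} {t : ℕ} (ht : t < T)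
    (hx : xhat ω u t = xhat ω' u' t) (hu : u t = u' t) : l ω u (t + 1) = l ω' u' (t + 1) := by
  funext n k e
  obtain ⟨e, he, heC⟩ := e
  refine val_eq_of_held hx hu (S.past (t + 1) ht n k e he).1 (S.held t ht n k e he) ?_
  intro m hm
  rcases lt_or_ge m n with hmn | hmn
  · exact Set.disjoint_left.1 (S.separated (t + 1) ht m n hmn k) ⟨he, heC⟩
      (C_mono t.le_succ ht m hm)
  · exact heC (condInfo_subset t.le_succ ht (Fin.le_def.1 hmn) ⟨m.2, hm⟩).2

/-- The new state is a controlled Markov process. -/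
theorem xhat_succ_congr {ω ω' : S.Prim} {u u' : S.Acts} {t : ℕ} (ht : t < T)
    (hx : xhat ω u t = xhat ω' u' t) (hu : u t = u' t) (hw : ω.w t = ω'.w t)
    (hv : ω.v (t + 1) = ω'.v (t + 1)) : xhat ω u (t + 1) = xhat ω' u' (t + 1) := by
  have h1 : x ω u (t + 1) = x ω' u' (t + 1) := by
    have : x ω u t = x ω' u' t := congrArg Prod.fst hx
    simp only [x]
    rw [this, hu, hw]
  have h2 : y ω u (t + 1) = y ω' u' (t + 1) := by
    funext n k
    simp only [y]
    rw [h1, hv]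
  simp only [xhat]
  rw [h1, h2, l_succ_congr ht hx hu]

/-- The feedback equation of a control strategy. -/
theorem actions_eq (hK : ∀ n, 0 < K n) (g : S.ControlStrategy) (ω : S.Prim) {t : ℕ} (ht : t ≤ T) :
    actions g ω t = fun n k => g t n k (y ω (actions g ω) t n k) (l ω (actions g ω) t n k)
      (c ω (actions g ω) t n) := by
  refine causalFix_eq _ t fun u u' huu => ?_
  have hω := Prim.AgreeUpTo.refl ω t
  funext n k
  rw [y_congr hω huu, l_congr ht hω huu, c_eq_iff.2 (cond_congr hK n ht hω huu)]

/-- The feedback equation has only one solution. -/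
theorem eq_actions (hK : ∀ n, 0 < K n) (g : S.ControlStrategy) (ω : S.Prim) {u : S.Acts}
    (hu : ∀ t ≤ T, u t = fun n k => g t n k (y ω u t n k) (l ω u t n k) (c ω u t n))
    {t : ℕ} (ht : t ≤ T) : u t = actions g ω t := by
  induction t using Nat.strong_induction_on with
  | _ t ih =>
    have huu : ∀ s < t, u s = actions g ω s := fun s hs => ih s hs (by omega)
    have hω := Prim.AgreeUpTo.refl ω t
    rw [hu t ht, actions_eq hK g ω ht]
    funext n k
    rw [y_congr hω huu, l_congr ht hω huu, c_eq_iff.2 (cond_congr hK n ht hω huu)]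

/-! ### The dynamics of the information states -/

/-- The information state `Π_t^j` that results from `ω` under the complete actions `A` of
level `j`. -/
noncomputable def infoState {j : ℕ} (hj : j < N) (A : ∀ t, S.CompleteAction t j) (ω : S.Prim)
    (t : ℕ) : Set (S.Lvl t j) :=
  feasible (simulate j hj.le A) t ⟨j, hj⟩ (c ω (simulate j hj.le A ω).1 t ⟨j, hj⟩)

/-- The complete actions of level `j` to which complete actions `A` of level `j + 1` amount when
the primitive variables are `ω`. -/
noncomputable def realized {j : ℕ} (hj : j < N) (A : ∀ t, S.CompleteAction t (j + 1))
    (ω : S.Prim) : ∀ t, S.CompleteAction t j :=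
  causalFix fun B t => (A t).fix (infoState hj B ω t)

theorem simulate_succ {j : ℕ} (hj : j < N) (A : ∀ t, S.CompleteAction t (j + 1)) (ω : S.Prim) :
    simulate (j + 1) hj A ω =
      ((simulate j hj.le (realized hj A ω) ω).1, fun t =>
        ((simulate j hj.le (realized hj A ω) ω).2 t, infoState hj (realized hj A ω) ω t)) :=
  rfl

theorem simulate_zero (A : ∀ t, S.CompleteAction t 0) (ω : S.Prim) :
    simulate 0 (Nat.zero_le N) A ω =
      (actions (fun t n k yk lk _ =>
        A t n (fun i _ hi => absurd hi (Nat.not_lt_zero i)) k yk lk) ω, fun t => xhat ω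
        (actions (fun t n k yk lk _ =>
        A t n (fun i _ hi => absurd hi (Nat.not_lt_zero i)) k yk lk) ω) t) :=
  rfl

theorem mem_infoState {j : ℕ} (hj : j < N) {A : ∀ t, S.CompleteAction t j} {ω : S.Prim} {t : ℕ}
    {s : S.Lvl t j} : s ∈ infoState hj A ω t ↔
      ∃ ω', cond ω' (simulate j hj.le A ω').1 t j = cond ω (simulate j hj.le A ω).1 t j ∧
        (simulate j hj.le A ω').2 t = s := by
  simp only [infoState, feasible, Set.mem_ofPred_eq, c_eq_iff]

theorem self_mem_infoState {j : ℕ} (hj : j < N) (A : ∀ t, S.CompleteAction t j) (ω : S.Prim)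
    (t : ℕ) : (simulate j hj.le A ω).2 t ∈ infoState hj A ω t :=
  (mem_infoState hj).2 ⟨ω, rfl, rfl⟩

variable (S) in
/-- The process `(X̂_t, Π_t^0, …, Π_t^{j-1})` is a controlled Markov process with the complete
actions of level `j` as its inputs, and the control actions and the new information are functions
of its state and input. -/
structure IsMarkov (j : ℕ) (hj : j ≤ N) : Prop where
  init : ∀ (A A' : ∀ t, S.CompleteAction t j) (ω ω' : S.Prim), ω.AgreeUpTo ω' 0 →
    (simulate j hj A ω).2 0 = (simulate j hj A' ω').2 0
  acts : ∀ (A A' : ∀ t, S.CompleteAction t j) (ω ω' : S.Prim), ∀ t < T,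
    (simulate j hj A ω).2 t = (simulate j hj A' ω').2 t → A t = A' t →
    (simulate j hj A ω).1 t = (simulate j hj A' ω').1 t
  newInfo : ∀ (A A' : ∀ t, S.CompleteAction t j) (ω ω' : S.Prim), ∀ t < T,
    (simulate j hj A ω).2 t = (simulate j hj A' ω').2 t → A t = A' t →
    ∀ i, ∀ e ∈ S.condInfo (t + 1) i, e ∉ S.condInfo t i →
      val ω (simulate j hj A ω).1 e = val ω' (simulate j hj A' ω').1 e
  step : ∀ (A A' : ∀ t, S.CompleteAction t j) (ω ω' : S.Prim), ∀ t < T,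
    (simulate j hj A ω).2 t = (simulate j hj A' ω').2 t → A t = A' t →
    ω.w t = ω'.w t → ω.v (t + 1) = ω'.v (t + 1) →
    (simulate j hj A ω).2 (t + 1) = (simulate j hj A' ω').2 (t + 1)

namespace IsMarkov

variable {j : ℕ} {A A' : ∀ t, S.CompleteAction t j} {ω ω' : S.Prim} {t : ℕ}

theorem simulate_state_congr {hj : j ≤ N} (H : S.IsMarkov j hj) (ht : t ≤ T)
    (hω : ω.AgreeUpTo ω' t) (hA : ∀ s < t, A s = A' s) :
    (simulate j hj A ω).2 t = (simulate j hj A' ω').2 t := by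
  induction t with
  | zero => exact H.init A A' ω ω' hω
  | succ t ih =>
    exact H.step A A' ω ω' t ht
      (ih (by omega) (hω.mono t.le_succ) fun s hs => hA s (by omega)) (hA t (by omega))
      (hω.2.1 t (by omega)) (hω.2.2 (t + 1) le_rfl)

theorem simulate_acts_congr {hj : j ≤ N} (H : S.IsMarkov j hj) (ht : t ≤ T)
    (hω : ω.AgreeUpTo ω' t) (hA : ∀ s < t, A s = A' s) :
    ∀ s < t, (simulate j hj A ω).1 s = (simulate j hj A' ω').1 s :=
  fun s hs => H.acts A A' ω ω' s (by omega)
    (H.simulate_state_congr (by omega) (hω.mono hs.le) fun r hr => hA r (by omega)) (hA s hs)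

theorem simulate_cond_congr (hK : ∀ n, 0 < K n) {hj : j ≤ N} (H : S.IsMarkov j hj) (i : ℕ)
    (ht : t ≤ T) (hω : ω.AgreeUpTo ω' t) (hA : ∀ s < t, A s = A' s) :
    cond ω (simulate j hj A ω).1 t i = cond ω' (simulate j hj A' ω').1 t i :=
  cond_congr hK i ht hω (H.simulate_acts_congr ht hω hA)

/-- The information state at time `t` depends on the realization of the common information and on
earlier complete actions only. -/
theorem infoState_congr (hK : ∀ n, 0 < K n) {hj : j < N} (H : S.IsMarkov j hj.le) (ht : t ≤ T)
    (hA : ∀ s < t, A s = A' s)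
    (hc : cond ω (simulate j hj.le A ω).1 t j = cond ω' (simulate j hj.le A' ω').1 t j) :
    infoState hj A ω t = infoState hj A' ω' t := by
  ext s
  simp only [mem_infoState]
  refine exists_congr fun ω₁ => ?_
  have h := Prim.AgreeUpTo.refl ω₁ t
  rw [H.simulate_cond_congr hK j ht h hA, H.simulate_state_congr ht h hA, hc]

theorem infoState_zero (hK : ∀ n, 0 < K n) {hj : j < N} (H : S.IsMarkov j hj.le) :
    infoState hj A ω 0 = infoState hj A' ω' 0 :=
  H.infoState_congr hK (Nat.zero_le T) (fun _ hs => absurd hs (Nat.not_lt_zero _))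
    (cond_zero hK ..)

theorem infoState_succ_subset (hK : ∀ n, 0 < K n) {hj : j < N} (H : S.IsMarkov j hj.le)
    (ht : t < T) (hP : infoState hj A ω t = infoState hj A' ω' t) (hA : A t = A' t)
    (hz : ∀ e ∈ S.condInfo (t + 1) j, e ∉ S.condInfo t j →
      val ω (simulate j hj.le A ω).1 e = val ω' (simulate j hj.le A' ω').1 e) :
    infoState hj A ω (t + 1) ⊆ infoState hj A' ω' (t + 1) := by
  intro s hs
  obtain ⟨ω₁, h1, rfl⟩ := (mem_infoState hj).1 hs
  have h2 : (simulate j hj.le A ω₁).2 t ∈ infoState hj A' ω' t :=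
    hP ▸ (mem_infoState hj).2 ⟨ω₁, cond_mono t.le_succ ht le_rfl h1, rfl⟩
  obtain ⟨ω₂, h3, h4⟩ := (mem_infoState hj).1 h2
  -- Continue the realization `ω₂` with the disturbances and noises of `ω₁`.
  set ω₃ := ω₂.splice ω₁ t
  have hω : ω₃.AgreeUpTo ω₂ t := ω₂.splice_agree ω₁ t
  have h5 : (simulate j hj.le A' ω₃).2 t = (simulate j hj.le A ω₁).2 t :=
    (H.simulate_state_congr ht.le hω fun _ _ => rfl).trans h4
  refine (mem_infoState hj).2 ⟨ω₃, cond_succ ?_ ?_, ?_⟩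
  · exact (H.simulate_cond_congr hK j ht.le hω fun _ _ => rfl).trans h3
  · intro e he he'
    rw [H.newInfo A' A ω₃ ω₁ t ht h5 hA.symm j e he he', ← hz e he he']
    exact cond_eq_iff.1 h1 e he
  · exact H.step A' A ω₃ ω₁ t ht h5 hA.symm (ω₂.splice_w ω₁ t) (ω₂.splice_v ω₁ t)

/-- The information state is updated from its previous value, the complete action and the new
information. -/
theorem infoState_succ_congr (hK : ∀ n, 0 < K n) {hj : j < N} (H : S.IsMarkov j hj.le)
    (ht : t < T) (hP : infoState hj A ω t = infoState hj A' ω' t) (hA : A t = A' t)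
    (hz : ∀ e ∈ S.condInfo (t + 1) j, e ∉ S.condInfo t j →
      val ω (simulate j hj.le A ω).1 e = val ω' (simulate j hj.le A' ω').1 e) :
    infoState hj A ω (t + 1) = infoState hj A' ω' (t + 1) :=
  Set.Subset.antisymm (H.infoState_succ_subset hK ht hP hA hz)
    (H.infoState_succ_subset hK ht hP.symm hA.symm fun e he he' => (hz e he he').symm)

theorem realized_eq (hK : ∀ n, 0 < K n) {hj : j < N} (H : S.IsMarkov j hj.le)
    (A : ∀ t, S.CompleteAction t (j + 1)) (ω : S.Prim) (ht : t ≤ T) :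
    realized hj A ω t = (A t).fix (infoState hj (realized hj A ω) ω t) := by
  refine causalFix_eq _ t fun B B' hB => ?_
  rw [H.infoState_congr hK ht hB
    (H.simulate_cond_congr hK j ht (Prim.AgreeUpTo.refl ω t) hB)]

end IsMarkov

theorem isMarkov_zero (hK : ∀ n, 0 < K n) : S.IsMarkov 0 (Nat.zero_le N) := by
  have acts : ∀ (A A' : ∀ t, S.CompleteAction t 0) (ω ω' : S.Prim), ∀ t < T,
      (simulate 0 (Nat.zero_le N) A ω).2 t = (simulate 0 (Nat.zero_le N) A' ω').2 t →
      A t = A' t →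
      (simulate 0 (Nat.zero_le N) A ω).1 t = (simulate 0 (Nat.zero_le N) A' ω').1 t := by
    intro A A' ω ω' t ht hx hA
    simp only [simulate_zero] at hx ⊢
    rw [actions_eq hK _ ω ht.le, actions_eq hK _ ω' ht.le]
    funext n k
    have := Prod.ext_iff.1 (congrFun (congrFun (congrArg Prod.snd hx) n) k)
    simp only [xhat] at this
    rw [this.1, this.2, hA]
  refine ⟨fun A A' ω ω' hω => ?_, acts, fun A A' ω ω' t ht hx hA i e he he' => ?_,
    fun A A' ω ω' t ht hx hA hw hv => ?_⟩
  · exact xhat_congr (Nat.zero_le T) hω fun s hs => absurd hs (Nat.not_lt_zero s)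
  · exact newInfo_congr hK ht hx (acts A A' ω ω' t ht hx hA) he he'
  · exact xhat_succ_congr ht hx (acts A A' ω ω' t ht hx hA) hw hv

theorem IsMarkov.succ (hK : ∀ n, 0 < K n) {j : ℕ} {hj : j < N} (H : S.IsMarkov j hj.le) :
    S.IsMarkov (j + 1) hj := by
  have key : ∀ (A A' : ∀ t, S.CompleteAction t (j + 1)) (ω ω' : S.Prim), ∀ t < T,
      (simulate (j + 1) hj A ω).2 t = (simulate (j + 1) hj A' ω').2 t → A t = A' t →
      (simulate j hj.le (realized hj A ω) ω).2 t = (simulate j hj.le (realized hj A' ω') ω').2 t ∧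
      infoState hj (realized hj A ω) ω t = infoState hj (realized hj A' ω') ω' t ∧
      realized hj A ω t = realized hj A' ω' t := by
    intro A A' ω ω' t ht hs hA
    simp only [simulate_succ] at hs
    obtain ⟨h1, h2⟩ := Prod.ext_iff.1 hs
    refine ⟨h1, h2, ?_⟩
    rw [H.realized_eq hK A ω ht.le, H.realized_eq hK A' ω' ht.le, hA]
    exact congrArg _ h2
  refine ⟨fun A A' ω ω' hω => ?_, fun A A' ω ω' t ht hs hA => ?_,
    fun A A' ω ω' t ht hs hA i e he he' => ?_, fun A A' ω ω' t ht hs hA hw hv => ?_⟩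
  · simp only [simulate_succ]
    rw [H.init _ (realized hj A' ω') ω ω' hω,
      H.infoState_zero hK (A' := realized hj A' ω') (ω' := ω')]
  · obtain ⟨h1, -, h3⟩ := key A A' ω ω' t ht hs hA
    exact H.acts _ _ _ _ t ht h1 h3
  · obtain ⟨h1, -, h3⟩ := key A A' ω ω' t ht hs hA
    exact H.newInfo _ _ _ _ t ht h1 h3 i e he he'
  · obtain ⟨h1, h2, h3⟩ := key A A' ω ω' t ht hs hA
    exact Prod.ext (H.step _ _ _ _ t ht h1 h3 hw hv)
      (H.infoState_succ_congr hK ht h2 h3 (H.newInfo _ _ _ _ t ht h1 h3 j))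

theorem isMarkov (hK : ∀ n, 0 < K n) (j : ℕ) (hj : j ≤ N) : S.IsMarkov j hj := by
  induction j with
  | zero => exact isMarkov_zero hK
  | succ j ih => exact IsMarkov.succ hK (ih (Nat.le_of_succ_le hj))

/-! ### Tuples of information states -/

/-- Remove `Π_t^j` from `(Π_t^m, …, Π_t^j)`. -/
def InfoTuple.init {t m j : ℕ} (p : S.InfoTuple t m (j + 1)) : S.InfoTuple t m j :=
  fun i hm hi => p i hm (by omega)

theorem InfoTuple.init_append {t m j : ℕ} (p : S.InfoTuple t m j) (P : Set (S.Lvl t j)) :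
    (p.append P).init = p := by
  funext i hm hi
  simp [InfoTuple.init, InfoTuple.append, hi]

theorem InfoTuple.append_last {t m j : ℕ} (p : S.InfoTuple t m j) (P : Set (S.Lvl t j))
    (hm : m ≤ j) : p.append P j hm j.lt_succ_self = P := by
  simp [InfoTuple.append]

/-- The tuple `(Π_t^m, …, Π_t^{j-1})` contained in `(X̂_t, Π_t^0, …, Π_t^{j-1})`. -/
def Lvl.tuple {t j : ℕ} (s : S.Lvl t j) (m : ℕ) : S.InfoTuple t m j :=
  fun i _ hi => Lvl.info j s i hi

theorem Lvl.tuple_succ {t j : ℕ} (s : S.Lvl t j) (P : Set (S.Lvl t j)) (m : ℕ) :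
    Lvl.tuple (j := j + 1) (s, P) m = (Lvl.tuple s m).append P :=
  rfl

/-- The component `X_t` of `(X̂_t, Π_t^0, …, Π_t^{j-1})`. -/
def Lvl.state {t : ℕ} : ∀ {j : ℕ}, S.Lvl t j → S.X t
  | 0, s => s.1
  | _ + 1, s => Lvl.state s.1

theorem state_simulate {j : ℕ} (hj : j ≤ N) (A : ∀ t, S.CompleteAction t j) (ω : S.Prim) (t : ℕ) :
    Lvl.state ((simulate j hj A ω).2 t) = x ω (simulate j hj A ω).1 t := by
  induction j with
  | zero => rfl
  | succ j ih => exact ih (Nat.le_of_succ_le hj) (realized hj A ω)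

/-- The control actions result from applying the complete actions to the information states that
occur. -/
theorem simulate_acts (hK : ∀ n, 0 < K n) {j : ℕ} (hj : j ≤ N) (A : ∀ t, S.CompleteAction t j)
    (ω : S.Prim) {t : ℕ} (ht : t ≤ T) :
    (simulate j hj A ω).1 t = fun n k => A t n (Lvl.tuple ((simulate j hj A ω).2 t) n) k
      (y ω (simulate j hj A ω).1 t n k) (l ω (simulate j hj A ω).1 t n k) := by
  induction j with
  | zero =>
    simp only [simulate_zero]
    refine (actions_eq hK _ ω ht).trans ?_
    funext n k
    congr 1
  | succ j ih =>
    refine (ih (Nat.le_of_succ_le hj) (realized hj A ω)).trans ?_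
    funext n k
    rw [(isMarkov hK j (Nat.le_of_succ_le hj)).realized_eq hK A ω ht]
    rfl

/-- The information states `Π_t^n, …, Π_t^{j-1}` are functions of the common information of
subsystem `n`. -/
theorem tuple_simulate_congr (hK : ∀ n, 0 < K n) {j : ℕ} (hj : j ≤ N)
    (A : ∀ t, S.CompleteAction t j) {ω ω' : S.Prim} {t : ℕ} (ht : t ≤ T) {n : ℕ}
    (hc : cond ω (simulate j hj A ω).1 t n = cond ω' (simulate j hj A ω').1 t n) :
    Lvl.tuple ((simulate j hj A ω).2 t) n = Lvl.tuple ((simulate j hj A ω').2 t) n := by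
  induction j with
  | zero => funext i _ hi; exact absurd hi (Nat.not_lt_zero i)
  | succ j ih =>
    have H := isMarkov (S := S) hK j (Nat.le_of_succ_le hj)
    simp only [simulate_succ] at hc ⊢
    simp only [Lvl.tuple_succ]
    rcases lt_or_ge j n with hn | hn
    · funext i hm hi
      omega
    -- `Π^j` and hence the complete actions of level `j` that are applied are the same so far.
    have hP : ∀ s, s ≤ t → (∀ r < s, realized hj A ω r = realized hj A ω' r) →
        infoState hj (realized hj A ω) ω s = infoState hj (realized hj A ω') ω' s :=
      fun s hs hr => H.infoState_congr hK (by omega) hr (cond_mono hs ht hn hc)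
    have hB : ∀ s, s ≤ t → realized hj A ω s = realized hj A ω' s := by
      intro s
      induction s using Nat.strong_induction_on with
      | _ s ihs =>
        intro hs
        rw [H.realized_eq hK A ω (hs.trans ht), H.realized_eq hK A ω' (hs.trans ht),
          hP s hs fun r hr => ihs r hr (by omega)]
    have hB' : ∀ s < t, realized hj A ω s = realized hj A ω' s := fun s hs => hB s hs.le
    have hω' := Prim.AgreeUpTo.refl ω' t
    rw [hP t le_rfl hB', ih (Nat.le_of_succ_le hj) (realized hj A ω)
      (hc.trans (H.simulate_cond_congr hK n ht hω' hB').symm),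
      H.simulate_state_congr ht hω' hB']

/-! ### Adapted policies -/

/-- A policy of level `j`, that is, a family of complete actions depending on the primitive
variables, is adapted if the complete action of each subsystem `m < j` is determined by the common
information of subsystem `j`, and the partial action of each subsystem `m ≥ j` by the common
information of subsystem `m`. Up to time `T`, an adapted policy of level `N` does not
depend on the primitive variables. -/
def Adapted {j : ℕ} (hj : j ≤ N) (α : S.Prim → ∀ t, S.CompleteAction t j) : Prop :=
  ∀ t ≤ T, ∀ (m : Fin N) (ω ω' : S.Prim),
    cond ω (simulate j hj (α ω) ω).1 t (max m j) =
      cond ω' (simulate j hj (α ω') ω').1 t (max m j) → α ω t m = α ω' t m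

/-- If `ω` yields the common information of `ω₀` under the complete actions that the policy
prescribes for `ω₀`, then the policy prescribes the same complete actions for `ω`. -/
theorem Adapted.eq_of_cond_eq (hK : ∀ n, 0 < K n) {j : ℕ} {hj : j ≤ N}
    {α : S.Prim → ∀ t, S.CompleteAction t j} (hα : Adapted hj α) {ω ω₀ : S.Prim} {t : ℕ}
    (ht : t ≤ T) (hc : cond ω (simulate j hj (α ω₀) ω).1 t j =
      cond ω₀ (simulate j hj (α ω₀) ω₀).1 t j) {s : ℕ} (hs : s ≤ t) : α ω s = α ω₀ s := by
  have H := isMarkov (S := S) hK j hj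
  induction s using Nat.strong_induction_on with
  | _ s ih =>
    funext m
    refine hα s (hs.trans ht) m ω ω₀ ?_
    rw [H.simulate_cond_congr hK _ (hs.trans ht) (Prim.AgreeUpTo.refl ω s)
      (A' := α ω₀) fun r hr => ih r hr (by omega)]
    exact cond_mono hs ht (le_max_right _ _) hc

section Coarsen

variable {j : ℕ} (hj : j < N) (α : S.Prim → ∀ t, S.CompleteAction t j)

/-- A realization of the primitive variables that, under the policy `α`, yields the information
state `P` and the realization `cc` of `C_t^{j+1}` (arbitrary if there is none). -/
noncomputable def representative (t : ℕ) (P : Set (S.Lvl t j))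
    (cc : ∀ e : S.condInfo t (j + 1), S.Val e.1) : S.Prim :=
  Classical.epsilon fun ω => infoState hj (α ω) ω t = P ∧
    cond ω (simulate j hj.le (α ω) ω).1 t (j + 1) = cc

/-- A realization of the primitive variables that, under the policy `α`, yields the realization
`cc` of `C_t^{j+1}` (arbitrary if there is none). -/
noncomputable def representative' (t : ℕ) (cc : ∀ e : S.condInfo t (j + 1), S.Val e.1) : S.Prim :=
  Classical.epsilon fun ω => cond ω (simulate j hj.le (α ω) ω).1 t (j + 1) = cc

/-- The policy of level `j + 1` obtained from a policy `α` of level `j`: given `(Π_t^j, C_t^{j+1})`,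
subsystem `j` and its predecessors do what `α` does on one fixed realization with the same value of
`(Π_t^j, C_t^{j+1})`. The subsystems after `j` need not know `Π_t^j`; they do what
`α` does on a realization with the same value of `C_t^{j+1}`. -/
noncomputable def coarsen (ω : S.Prim) : ∀ t, S.CompleteAction t (j + 1) :=
  causalFix fun B t m p =>
    if h : (m : ℕ) ≤ j then
      α (representative hj α t (p j h j.lt_succ_self)
        (cond ω (simulate (j + 1) hj B ω).1 t (j + 1))) t m p.init
    else α (representative' hj α t (cond ω (simulate (j + 1) hj B ω).1 t (j + 1))) t m p.init

/-- The complete actions of level `j` that result from the policy `coarsen hj α`. -/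
noncomputable abbrev coarsened (ω : S.Prim) : ∀ t, S.CompleteAction t j :=
  realized hj (coarsen hj α ω) ω

variable {hj α}

theorem coarsen_eq (hK : ∀ n, 0 < K n) (ω : S.Prim) {t : ℕ} (ht : t ≤ T) :
    coarsen hj α ω t = fun (m : Fin N) p =>
      if h : (m : ℕ) ≤ j then
        α (representative hj α t (p j h j.lt_succ_self)
          (cond ω (simulate j hj.le (coarsened hj α ω) ω).1 t (j + 1))) t m p.init
      else α (representative' hj α t
        (cond ω (simulate j hj.le (coarsened hj α ω) ω).1 t (j + 1))) t m p.init := by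
  refine causalFix_eq _ t fun B B' hB => ?_
  rw [(isMarkov (S := S) hK (j + 1) hj).simulate_cond_congr hK (j + 1) ht
    (Prim.AgreeUpTo.refl ω t) hB]

theorem coarsened_eq (hK : ∀ n, 0 < K n) (ω : S.Prim) {t : ℕ} (ht : t ≤ T) (m : Fin N) :
    coarsened hj α ω t m =
      if (m : ℕ) ≤ j then
        α (representative hj α t (infoState hj (coarsened hj α ω) ω t)
          (cond ω (simulate j hj.le (coarsened hj α ω) ω).1 t (j + 1))) t m
      else α (representative' hj α t
        (cond ω (simulate j hj.le (coarsened hj α ω) ω).1 t (j + 1))) t m := by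
  have h : coarsened hj α ω t = _ :=
    (isMarkov (S := S) hK j hj.le).realized_eq hK (hj := hj) (coarsen hj α ω) ω ht
  funext p
  rw [congrFun (congrFun h m) p, CompleteAction.fix, coarsen_eq hK ω ht]
  simp only [InfoTuple.init_append]
  split_ifs with hm
  · rw [InfoTuple.append_last _ _ hm]
  · rfl

theorem representative_spec {t : ℕ} {P : Set (S.Lvl t j)}
    {cc : ∀ e : S.condInfo t (j + 1), S.Val e.1}
    (h : ∃ ω, infoState hj (α ω) ω t = P ∧ cond ω (simulate j hj.le (α ω) ω).1 t (j + 1) = cc) :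
    infoState hj (α (representative hj α t P cc)) (representative hj α t P cc) t = P ∧
    cond (representative hj α t P cc) (simulate j hj.le (α (representative hj α t P cc))
      (representative hj α t P cc)).1 t (j + 1) = cc :=
  Classical.epsilon_spec h

theorem representative'_spec {t : ℕ} {cc : ∀ e : S.condInfo t (j + 1), S.Val e.1}
    (h : ∃ ω, cond ω (simulate j hj.le (α ω) ω).1 t (j + 1) = cc) :
    cond (representative' hj α t cc) (simulate j hj.le (α (representative' hj α t cc))
      (representative' hj α t cc)).1 t (j + 1) = cc :=
  Classical.epsilon_spec h

/-- Where `(Π_t^j, C_t^{j+1})` has a value that occurs under `α`, the coarsened policy does exactly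
what `α` does on the fixed realization with this value. -/
theorem coarsened_eq_representative (hK : ∀ n, 0 < K n) (hα : Adapted hj.le α) {ω : S.Prim} {t : ℕ}
    (ht : t ≤ T)
    (h : ∃ ω', infoState hj (α ω') ω' t = infoState hj (coarsened hj α ω) ω t ∧
      cond ω' (simulate j hj.le (α ω') ω').1 t (j + 1) =
        cond ω (simulate j hj.le (coarsened hj α ω) ω).1 t (j + 1)) :
    coarsened hj α ω t = α (representative hj α t (infoState hj (coarsened hj α ω) ω t)
          (cond ω (simulate j hj.le (coarsened hj α ω) ω).1 t (j + 1))) t := by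
  funext m
  rw [coarsened_eq hK ω ht m]
  split_ifs with hm
  · rfl
  · refine hα t ht m _ _ (cond_mono (i := j + 1) le_rfl ht (by omega) ?_)
    rw [(representative_spec h).2]
    exact representative'_spec (h.imp fun _ h => h.2)

/-- Every value of `(Π_t^j, C_t^{j+1})` that occurs under the coarsened policy occurs under `α`. -/
theorem exists_infoState_eq (hK : ∀ n, 0 < K n) (hα : Adapted hj.le α) {t : ℕ} (ht : t ≤ T)
    (ω : S.Prim) :
    ∃ ω', infoState hj (α ω') ω' t = infoState hj (coarsened hj α ω) ω t ∧
      cond ω' (simulate j hj.le (α ω') ω').1 t (j + 1) =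
        cond ω (simulate j hj.le (coarsened hj α ω) ω).1 t (j + 1) := by
  have H := isMarkov (S := S) hK j hj.le
  induction t with
  | zero => exact ⟨ω, H.infoState_zero hK, cond_zero hK ..⟩
  | succ t ih =>
    have ih := ih (Nat.le_of_succ_le ht)
    have htT : t ≤ T := Nat.le_of_succ_le ht
    have hact := coarsened_eq_representative hK hα htT ih
    obtain ⟨hP, hcc⟩ := representative_spec ih
    set A := coarsened hj α ω
    set ω₂ := representative hj α t (infoState hj A ω t) (cond ω (simulate j hj.le A ω).1 t (j + 1))
    obtain ⟨ω₃, h3, h4⟩ := (mem_infoState hj).1 (hP ▸ self_mem_infoState hj A ω t)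
    -- `ω₃` reaches under `α` the current state of `ω`; from there on, follow `ω`.
    set ω₄ := ω₃.splice ω t
    have hω : ω₄.AgreeUpTo ω₃ t := ω₃.splice_agree ω t
    have hc : cond ω₄ (simulate j hj.le (α ω₂) ω₄).1 t j =
        cond ω₂ (simulate j hj.le (α ω₂) ω₂).1 t j :=
      (H.simulate_cond_congr hK j htT hω fun _ _ => rfl).trans h3
    have hα4 : ∀ s ≤ t, α ω₄ s = α ω₂ s := fun s hs => hα.eq_of_cond_eq hK htT hc hs
    have hα4' : ∀ s < t, α ω₄ s = α ω₂ s := fun s hs => hα4 s hs.le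
    have hc4 : cond ω₄ (simulate j hj.le (α ω₄) ω₄).1 t j =
        cond ω₂ (simulate j hj.le (α ω₂) ω₂).1 t j :=
      (H.simulate_cond_congr hK j htT (Prim.AgreeUpTo.refl ω₄ t) hα4').trans hc
    have hs4 : (simulate j hj.le (α ω₄) ω₄).2 t = (simulate j hj.le A ω).2 t :=
      (H.simulate_state_congr htT hω hα4').trans h4
    have hA4 : α ω₄ t = A t := (hα4 t le_rfl).trans hact.symm
    have hnew := H.newInfo _ _ _ _ t ht hs4 hA4
    refine ⟨ω₄, H.infoState_succ_congr hK ht ?_ hA4 (hnew j), cond_succ ?_ (hnew (j + 1))⟩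
    · exact (H.infoState_congr hK htT hα4' hc4).trans hP
    · exact (cond_mono le_rfl htT j.le_succ hc4).trans hcc

/-- For a subsystem `m > j`, the realization chosen by `representative'` has the common information
`C_t^m` that has actually occurred, so that adaptedness carries over from `α`. -/
theorem Adapted.coarsen (hK : ∀ n, 0 < K n) (hα : Adapted hj.le α) :
    Adapted (j := j + 1) hj (coarsen hj α) := by
  intro t ht m ω ω' hc
  have hc : cond ω (simulate j hj.le (coarsened hj α ω) ω).1 t (max m (j + 1)) =
      cond ω' (simulate j hj.le (coarsened hj α ω') ω').1 t (max m (j + 1)) := hc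
  rw [coarsen_eq hK ω ht, coarsen_eq hK ω' ht]
  funext p
  by_cases hm : (m : ℕ) ≤ j
  · rw [max_eq_right (by omega)] at hc
    simp only [hm, dif_pos, hc]
  · simp only [hm, dif_neg, not_false_eq_true]
    refine congrFun (hα t ht m _ _ ?_) _
    have h : ∀ ω, cond (representative' hj α t _)
        (simulate j hj.le (α (representative' hj α t _)) (representative' hj α t _)).1 t (max m j) =
        cond ω (simulate j hj.le (coarsened hj α ω) ω).1 t (max m j) := fun ω =>
      cond_mono (i := j + 1) le_rfl ht (by omega)
        (representative'_spec ((exists_infoState_eq hK hα ht ω).imp fun _ h => h.2))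
    rw [h ω, h ω']
    rwa [show max (m : ℕ) j = max (m : ℕ) (j + 1) by omega]

/-- Every terminal state that occurs under the coarsened policy occurs under `α`. -/
theorem exists_state_eq (hK : ∀ n, 0 < K n) (hα : Adapted hj.le α) (ω : S.Prim) :
    ∃ ω', x ω' (simulate j hj.le (α ω') ω').1 T =
      x ω (simulate (j + 1) hj (coarsen hj α ω) ω).1 T := by
  have H := isMarkov (S := S) hK j hj.le
  obtain ⟨ω₁, hP, -⟩ := exists_infoState_eq hK hα le_rfl ω
  obtain ⟨ω₂, h2, h3⟩ := (mem_infoState hj).1 (hP ▸ self_mem_infoState hj (coarsened hj α ω) ω T)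
  refine ⟨ω₂, ?_⟩
  rw [← state_simulate, ← state_simulate]
  refine congrArg Lvl.state (Eq.trans ?_ h3)
  exact H.simulate_state_congr le_rfl (Prim.AgreeUpTo.refl ω₂ T)
    fun s hs => hα.eq_of_cond_eq hK le_rfl h2 hs.le

end Coarsen

/-! ### Structural strategies -/

/-- Every partial strategy gives rise, at each level `j`, to an adapted policy under which only
terminal states of the given strategy occur. -/
theorem exists_adapted (hK : ∀ n, 0 < K n) (g : S.PartialStrategy) (j : ℕ) (hj : j ≤ N) :
    ∃ α : S.Prim → ∀ t, S.CompleteAction t j, Adapted hj α ∧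
      ∀ ω, ∃ ω', x ω' (partialActions g ω') T = x ω (simulate j hj (α ω) ω).1 T := by
  induction j with
  | zero =>
    let α : S.Prim → ∀ t, S.CompleteAction t 0 :=
      fun ω t m _ => g t m (c ω (partialActions g ω) t m)
    have hα : ∀ ω, ∀ t ≤ T, partialActions g ω t = (simulate 0 hj (α ω) ω).1 t :=
      fun ω t ht => by
      simp only [simulate_zero]
      refine eq_actions hK _ ω (u := partialActions g ω) (fun t ht => ?_) ht
      exact actions_eq hK (fun t n k yk lk cn => g t n cn k yk lk) ω ht
    refine ⟨α, fun t ht m ω ω' hc => ?_, fun ω => ⟨ω, ?_⟩⟩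
    · have h : ∀ ω, c ω (partialActions g ω) t m = c ω (simulate 0 hj (α ω) ω).1 t m := fun ω =>
        c_eq_iff.2 (cond_congr hK m ht (Prim.AgreeUpTo.refl ω t) fun s hs => hα ω s (by omega))
      funext p
      change g t m _ = g t m _
      rw [max_eq_left (Nat.zero_le _), ← c_eq_iff] at hc
      rw [h ω, h ω', hc]
    · exact x_congr (Prim.AgreeUpTo.refl ω T) fun s hs => hα ω s hs.le
  | succ j ih =>
    obtain ⟨α, hα, h⟩ := ih (Nat.le_of_succ_le hj)
    refine ⟨coarsen hj α, hα.coarsen hK, fun ω => ?_⟩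
    obtain ⟨ω₁, h1⟩ := exists_state_eq (hj := hj) hK hα ω
    obtain ⟨ω₂, h2⟩ := h ω₁
    exact ⟨ω₂, h2.trans h1⟩

theorem exists_structural (hK : ∀ n, 0 < K n) (g : S.PartialStrategy) :
    ∃ gstar : S.StructuralPartialStrategy,
      ∀ ω, ∃ ω', x ω' (partialActions g ω') T = x ω (simulate N le_rfl gstar ω).1 T := by
  obtain ⟨α, hα, h⟩ := exists_adapted hK g N le_rfl
  let ω₀ : S.Prim := Classical.arbitrary _
  have hconst : ∀ ω, ∀ t ≤ T, α ω t = α ω₀ t := fun ω t ht => by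
    funext m
    refine hα t ht m ω ω₀ (cond_eq_iff.2 ?_)
    rintro e ⟨h, -⟩
    omega
  refine ⟨α ω₀, fun ω => ?_⟩
  obtain ⟨ω', h'⟩ := h ω
  refine ⟨ω', h'.trans (x_congr (Prim.AgreeUpTo.refl ω T) ?_)⟩
  exact (isMarkov (S := S) hK N le_rfl).simulate_acts_congr le_rfl (Prim.AgreeUpTo.refl ω T)
    fun s hs => hconst ω s hs.le

/-- A structural strategy is realized by a partial strategy, because information states are
functions of the common information. -/
theorem exists_partialStrategy (hK : ∀ n, 0 < K n) (gstar : S.StructuralPartialStrategy) :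
    ∃ g : S.PartialStrategy,
      (∀ ω, ∀ t ≤ T, partialActions g ω t = (simulate N le_rfl gstar ω).1 t) ∧
      ∀ ω, ∀ t ≤ T, ∀ n, g t n (c ω (partialActions g ω) t n) =
        gstar t n (infoStates gstar ω t n) := by
  classical
  let u : S.Prim → S.Acts := fun ω => (simulate N le_rfl gstar ω).1
  let g : S.PartialStrategy := fun t n cn =>
    if h : ∃ ω, c ω (u ω) t n = cn then gstar t n (infoStates gstar h.choose t n)
    else Classical.arbitrary _
  have hg : ∀ ω, ∀ t ≤ T, ∀ n, g t n (c ω (u ω) t n) = gstar t n (infoStates gstar ω t n) := by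
    intro ω t ht n
    have h : ∃ ω', c ω' (u ω') t n = c ω (u ω) t n := ⟨ω, rfl⟩
    simp only [g, dif_pos h]
    exact congrArg (gstar t n)
      (tuple_simulate_congr hK le_rfl gstar ht (c_eq_iff.1 h.choose_spec))
  have hu : ∀ ω, ∀ t ≤ T, u ω t = partialActions g ω t := by
    refine fun ω t ht => eq_actions hK _ ω (fun t ht => ?_) ht
    refine (simulate_acts hK le_rfl gstar ω ht).trans ?_
    funext n k
    rw [hg ω t ht n]
    rfl
  refine ⟨g, fun ω t ht => (hu ω t ht).symm, fun ω t ht n => ?_⟩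
  rw [← hg ω t ht n, c_eq_iff.2 (cond_congr hK n ht (Prim.AgreeUpTo.refl ω t)
    fun s hs => (hu ω s (by omega)).symm)]

/-! ### Optimality -/

theorem Jhat_mem_range (g : S.PartialStrategy) : Jhat g ∈ Set.range S.d := by
  have hfin : (Set.range fun ω : S.Prim => S.d (x ω (partialActions g ω) T)).Finite :=
    (Set.finite_range S.d).subset (by rintro _ ⟨ω, rfl⟩; exact ⟨_, rfl⟩)
  obtain ⟨ω, hω⟩ := (Set.range_nonempty _).csSup_mem hfin
  exact ⟨_, hω⟩

/-- An optimal partial strategy exists because the worst-case cost takes finitely many values. -/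
theorem exists_optimal : ∃ g : S.PartialStrategy, ∀ g' : S.PartialStrategy, Jhat g ≤ Jhat g' := by
  have hfin : (Set.range (Jhat (S := S))).Finite :=
    (Set.finite_range S.d).subset (by rintro _ ⟨g, rfl⟩; exact Jhat_mem_range g)
  obtain ⟨_, ⟨g, rfl⟩, hg⟩ := hfin.exists_minimal (Set.range_nonempty _)
  exact ⟨g, fun g' => (le_total (Jhat g) (Jhat g')).elim id fun h => hg ⟨g', rfl⟩ h⟩

theorem Jhat_le_of_states {g g' : S.PartialStrategy}
    (h : ∀ ω, ∃ ω', x ω' (partialActions g' ω') T = x ω (partialActions g ω) T) :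
    Jhat g ≤ Jhat g' := by
  refine ciSup_le fun ω => ?_
  obtain ⟨ω', h'⟩ := h ω
  have hbdd : BddAbove (Set.range fun ω : S.Prim => S.d (x ω (partialActions g' ω) T)) :=
    ((Set.finite_range S.d).subset (by rintro _ ⟨ω, rfl⟩; exact ⟨_, rfl⟩)).bddAbove
  exact (congrArg S.d h').symm.le.trans (le_ciSup hbdd ω')

theorem exists_optimal_structural (hK : ∀ n, 0 < K n) :
    ∃ (g : S.PartialStrategy) (gstar : S.StructuralPartialStrategy),
      (∀ g' : S.PartialStrategy, Jhat g ≤ Jhat g') ∧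
      ∀ (ω : S.Prim) (t : ℕ), t ≤ T → ∀ n : Fin N,
        g t n (c ω (partialActions g ω) t n) = gstar t n (infoStates gstar ω t n) := by
  obtain ⟨g₀, hg₀⟩ := exists_optimal (S := S)
  obtain ⟨gstar, hstar⟩ := exists_structural hK g₀
  obtain ⟨g, hg, hg'⟩ := exists_partialStrategy hK gstar
  refine ⟨g, gstar, fun g' => (Jhat_le_of_states fun ω => ?_).trans (hg₀ g'), hg'⟩
  obtain ⟨ω', h⟩ := hstar ω
  exact ⟨ω', h.trans (x_congr (Prim.AgreeUpTo.refl ω T) fun s hs => (hg ω s hs.le).symm)⟩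

end NestedSystem

theorem theorem4 {N : ℕ} {K : Fin N → ℕ} {T : ℕ} (hK : ∀ n, 0 < K n)
    (S : NestedSystem N K T) :
    (∃ (g : S.PartialStrategy) (gstar : S.StructuralPartialStrategy),
      (∀ g' : S.PartialStrategy, NestedSystem.Jhat g ≤ NestedSystem.Jhat g') ∧
      ∀ (ω : S.Prim) (t : ℕ), t ≤ T → ∀ n : Fin N,
        g t n (NestedSystem.c ω (NestedSystem.partialActions g ω) t n) =
          gstar t n (NestedSystem.infoStates gstar ω t n)) ∧
    (∃ (g : S.ControlStrategy) (gstar : S.StructuralControlStrategy),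
      (∀ g' : S.ControlStrategy, NestedSystem.J g ≤ NestedSystem.J g') ∧
      ∀ (ω : S.Prim) (t : ℕ), t ≤ T → ∀ (n : Fin N) (k : Fin (K n)),
        (∀ (yk : S.Y t n k) (lk : S.LVal t n k),
          g t n k yk lk (NestedSystem.c ω (NestedSystem.actions g ω) t n) =
            gstar t n k yk lk (NestedSystem.infoStates gstar.toPartial ω t n)) ∧
        NestedSystem.actions g ω t n k =
          gstar t n k (NestedSystem.y ω (NestedSystem.actions g ω) t n k)
            (NestedSystem.l ω (NestedSystem.actions g ω) t n k)
            (NestedSystem.infoStates gstar.toPartial ω t n)) := by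
  obtain ⟨g, gstar, hopt, hg⟩ := NestedSystem.exists_optimal_structural (S := S) hK
  -- The same strategies with reordered arguments solve the original problem; costs agree by `rfl`.
  refine ⟨⟨g, gstar, hopt, hg⟩, fun t n k yk lk cn => g t n cn k yk lk,
    fun t n k yk lk p => gstar t n p k yk lk, fun g' => ?_, fun ω t ht n k => ?_⟩
  · exact hopt fun t n cn k yk lk => g' t n k yk lk cn
  · have h := hg ω t ht n
    refine ⟨fun yk lk => congrFun (congrFun (congrFun h k) yk) lk, ?_⟩
    refine (congrFun (congrFun (NestedSystem.actions_eq hK _ ω ht) n) k).trans ?_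
    exact congrFun (congrFun (congrFun h k) _) _
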